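/- For a tree $T$ on $n$ vertices with edge set $E(T)$ and a set $S\subseteq E(T)$, let $\theta_T(S)$ be the partition of $n$ whose parts are the numbers of vertices of the connected components of the graph $T-S$ obtained from $T$ by deleting the edges in $S$ (and keeping all vertices). Let $n\ge 4$ and $3\le k\le n-3$. Then every tree on $n$ vertices (whether it has one centroid or two) is uniquely determined, as an edge-labeled tree and up to isomorphism, by its labeled $k$-cuts, that is, by the map $S\mapsto\theta_T(S)$ on the $k$-element sets $S\subseteq E(T)$. Precisely: let $T$ and $T'$ be trees on $n$ vertices and let $\sigma:E(T)\to E(T')$ be a bijection such that $\theta_T(S)=\theta_{T'}(\sigma(S))$ for every $S\subseteq E(T)$ with $|S|=k$. Then there is a graph isomorphism $\varphi:T\to T'$ that induces $\sigma$ on edges: $\varphi(e)=\sigma(e)$ for every $e\in E(T)$. In particular, $T$ and $T'$ are isomorphic. -/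

import Mathlib

/-- The cut map `θ_G(S)` of a finite simple graph `G`: the partition of the number of vertices of
`G` given by the sizes of the connected components of `G - S`, the graph obtained from `G` by
deleting the edges in `S` (and keeping all vertices). -/
noncomputable def SimpleGraph.cutPartition {V : Type*} [Fintype V] (G : SimpleGraph V)
    (S : Finset G.edgeSet) : Nat.Partition (Fintype.card V) := by
  classical
  exact
  { parts := (Finset.univ : Finset
      (G.deleteEdges {e | ∃ h : e ∈ G.edgeSet, ⟨e, h⟩ ∈ S}).ConnectedComponent).val.map
        fun c => c.supp.ncard
    parts_pos := by
      intro i hi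
      obtain ⟨c, -, rfl⟩ := Multiset.mem_map.1 hi
      exact (Set.ncard_pos (Set.toFinite _)).2 c.nonempty_supp
    parts_sum := by
      change ∑ c : (G.deleteEdges {e | ∃ h : e ∈ G.edgeSet, ⟨e, h⟩ ∈ S}).ConnectedComponent,
        c.supp.ncard = Fintype.card V
      rw [← Finset.card_univ, Finset.card_eq_sum_card_fiberwise
        (f := (G.deleteEdges {e | ∃ h : e ∈ G.edgeSet, ⟨e, h⟩ ∈ S}).connectedComponentMk)
        (t := Finset.univ) (by simp)]
      refine Finset.sum_congr rfl fun c _ => ?_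
      rw [← Set.ncard_coe_finset]
      congr 1
      ext v
      simp [SimpleGraph.ConnectedComponent.mem_supp_iff] }

/-- `T` and `T'` have the same labeled `k`-cuts under the identification `σ` of their edges: for
every set `S` of exactly `k` edges of `T`, the cut partitions `θ_T(S)` and `θ_{T'}(σ(S))` have the
same parts (with multiplicity). -/
def SimpleGraph.SameLabeledCuts {V W : Type*} [Fintype V] [Fintype W] (T : SimpleGraph V)
    (T' : SimpleGraph W) (σ : T.edgeSet ≃ T'.edgeSet) (k : ℕ) : Prop :=
  ∀ S : Finset T.edgeSet, S.card = k →
    (T.cutPartition S).parts = (T'.cutPartition (S.map σ.toEmbedding)).parts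

/-! The argument descends from `k`-cuts to cuts by at most three edges and then rebuilds the tree
from those.

Descent (`IsSplitting.eq`, `cutParts_eq_of_card_le`): a forest with at least three edges has its
component sizes determined by those of its edge-deleted subforests. Splitting a component into `a`
and `b` lowers the sum of squares by `2ab`, so the deletions with the largest sum of squares are
those of leaf edges in a smallest nontrivial component. Both forests have the same such edges, and
undoing one of these deletions leaves few possibilities. Three edges are needed: sizes `{2, 2}` and
`{3, 1}` both give only `{2, 1, 1}`. This is where `k ≤ n - 3` enters.

Reconstruction (`exists_equiv`): view a tree as its system of edge splits. For two edges exactly one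
of the four intersections of sides is empty, and these empty corners determine the tree, since
vertices are exactly the pairwise meeting choices of sides (`exists_side_eq`). 1-cuts give the side
sizes; if no side has `n/2` vertices, 2-cuts tell whether the smaller sides of two edges are nested
or disjoint. With two centroids, the edge joining them has no smaller side; 3-cuts tell which edges
lie in the same half, which fixes everything up to exchanging the halves. -/

set_option linter.unusedSectionVars false

/-! ### Component sizes of a forest from its edge-deleted subforests -/

/-- The sum of the squares of the entries of a multiset of natural numbers. -/
def Multiset.sumSq (m : Multiset ℕ) : ℕ := (m.map (· ^ 2)).sum

/-- `m` is a multiset of component sizes of a forest with edge set `A`; deleting the edge `f`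
splits a component of size `a f + b f` into components of sizes `a f` and `b f`, and leaves the
multiset `c f`. -/
structure IsSplitting {E : Type*} (A : Finset E) (m : Multiset ℕ) (c : E → Multiset ℕ)
    (a b : E → ℕ) : Prop where
  zero_notMem : 0 ∉ m
  left_pos : ∀ f ∈ A, 0 < a f
  right_pos : ∀ f ∈ A, 0 < b f
  split : ∀ f ∈ A, c f + {a f + b f} = m + {a f, b f}
  exists_of_mem : ∀ p ∈ m, 2 ≤ p → ∃ f ∈ A, a f + b f = p
  exists_leaves : ∀ f ∈ A, 3 ≤ a f + b f → ∃ g ∈ A, ∃ h ∈ A, g ≠ h ∧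
    (a g + b g = a f + b f ∧ (a g = 1 ∨ b g = 1)) ∧ (a h + b h = a f + b f ∧ (a h = 1 ∨ b h = 1))
  card_le : (A.filter fun f => a f + b f = 2).card ≤ m.count 2

namespace IsSplitting

variable {E : Type*} {A : Finset E} {m m' : Multiset ℕ} {c : E → Multiset ℕ} {a b a' b' : E → ℕ}

theorem sumSq_eq (h : IsSplitting A m c a b) {f : E} (hf : f ∈ A) :
    (c f).sumSq + 2 * (a f * b f) = m.sumSq := by
  have := congrArg Multiset.sumSq (h.split f hf)
  simp only [Multiset.sumSq, Multiset.map_add, Multiset.sum_add, Multiset.map_singleton,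
    Multiset.sum_singleton, Multiset.insert_eq_cons, Multiset.map_cons, Multiset.sum_cons] at this ⊢
  nlinarith

theorem exists_leaf (h : IsSplitting A m c a b) {f : E} (hf : f ∈ A) :
    ∃ g ∈ A, a g + b g = a f + b f ∧ (a g = 1 ∨ b g = 1) := by
  by_cases h3 : 3 ≤ a f + b f
  · obtain ⟨g, hg, -, -, -, h1, -⟩ := h.exists_leaves f hf h3
    exact ⟨g, hg, h1⟩
  · have := h.left_pos f hf
    have := h.right_pos f hf
    exact ⟨f, hf, rfl, by omega⟩

/-- Since `(a - 1)(b - 1) ≥ 0`, the loss `2ab` is at least `2(a + b - 1)`, with equality exactly for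
leaf edges. So the maximizers of `(c f).sumSq` are the leaf edges of the smallest components that
have an edge; `s` is the size of these. -/
theorem exists_min (h : IsSplitting A m c a b) (hA : A.Nonempty) :
    ∃ s, 2 ≤ s ∧ (∀ f ∈ A, s ≤ a f + b f) ∧
      (∀ f ∈ A, (c f).sumSq + 2 * (s - 1) ≤ m.sumSq) ∧
      (∀ f ∈ A, (c f).sumSq + 2 * (s - 1) = m.sumSq ↔ a f + b f = s ∧ (a f = 1 ∨ b f = 1)) ∧
      ∃ f ∈ A, a f + b f = s ∧ (a f = 1 ∨ b f = 1) := by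
  obtain ⟨f, hf, hmin⟩ := A.exists_min_image (fun f => a f + b f) hA
  have key : ∀ g ∈ A, a f + b f ≤ a g + b g ∧ a g + b g ≤ a g * b g + 1 ∧
      (a g * b g + 1 = a g + b g ↔ a g = 1 ∨ b g = 1) := by
    intro g hg
    have h1 := h.left_pos g hg
    have h2 := h.right_pos g hg
    obtain ⟨x, hx⟩ := Nat.exists_eq_add_of_le h1
    obtain ⟨y, hy⟩ := Nat.exists_eq_add_of_le h2
    refine ⟨hmin g hg, ?_, ?_⟩
    · rw [hx, hy]; nlinarith
    · rw [hx, hy]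
      constructor
      · intro h3
        have : x * y = 0 := by nlinarith
        rcases mul_eq_zero.1 this with h | h <;> simp [h]
      · rintro (h | h)
        · have : x = 0 := by omega
          subst this; ring
        · have : y = 0 := by omega
          subst this; ring
  have hp := h.left_pos f hf
  have hp' := h.right_pos f hf
  refine ⟨a f + b f, by omega, hmin, ?_, ?_, h.exists_leaf hf⟩
  · intro g hg
    have := h.sumSq_eq hg
    have := key g hg
    omega
  · intro g hg
    have := h.sumSq_eq hg
    obtain ⟨h1, h2, h3⟩ := key g hg
    rw [← h3]
    omega

theorem split_leaf (h : IsSplitting A m c a b) {f : E} (hf : f ∈ A) (hl : a f = 1 ∨ b f = 1) :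
    c f + {a f + b f} = m + {1, a f + b f - 1} := by
  rw [h.split f hf]
  rcases hl with h1 | h1 <;> rw [h1]
  · simp
  · rw [Multiset.pair_comm]; simp

/-- Undoing the deletion of a common leaf edge `f` gives `m + {s - 1, s'} = m' + {s' - 1, s}`, which
settles `s = s'`. The case `s < s'` is excluded by counting parts of size 1, 2 and `s - 1`. -/
theorem eq_of_le (h : IsSplitting A m c a b) (h' : IsSplitting A m' c a' b') (hA : 3 ≤ A.card)
    {s s' : ℕ} (hs : 2 ≤ s) (hss : s ≤ s')
    (hmin' : ∀ f ∈ A, s' ≤ a' f + b' f)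
    (hM : ∀ f ∈ A, a f + b f = s ∧ (a f = 1 ∨ b f = 1) ↔ a' f + b' f = s' ∧ (a' f = 1 ∨ b' f = 1))
    {f : E} (hf : f ∈ A) (hfs : a f + b f = s) (hfl : a f = 1 ∨ b f = 1) : m = m' := by
  obtain ⟨hfs', hfl'⟩ := (hM f hf).1 ⟨hfs, hfl⟩
  have e1 := h.split_leaf hf hfl
  have e2 := h'.split_leaf hf hfl'
  rw [hfs] at e1
  rw [hfs'] at e2
  have cnt : ∀ i, m.count i + (if i = s - 1 then 1 else 0) + (if i = s' then 1 else 0) =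
      m'.count i + (if i = s' - 1 then 1 else 0) + (if i = s then 1 else 0) := by
    intro i
    have c1 := congrArg (Multiset.count i) e1
    have c2 := congrArg (Multiset.count i) e2
    simp only [Multiset.count_add, Multiset.insert_eq_cons, Multiset.count_cons,
      Multiset.count_singleton] at c1 c2
    omega
  rcases hss.eq_or_lt with rfl | hlt
  · ext i
    have := cnt i
    omega
  exfalso
  -- Otherwise `m'` has a part `s - 1 ≥ 2`, below its smallest nontrivial part `s'`.
  have hs2 : s = 2 := by
    by_contra hne
    have := cnt (s - 1)
    rw [if_pos rfl, if_neg (by omega), if_neg (by omega), if_neg (by omega)] at this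
    have hmem : s - 1 ∈ m' := Multiset.count_pos.1 (by omega)
    obtain ⟨g, hg, hg'⟩ := h'.exists_of_mem _ hmem (by omega)
    have := hmin' g hg
    omega
  subst hs2
  have hm'2 : m'.count 2 = 0 := by
    rw [Multiset.count_eq_zero]
    intro hmem
    obtain ⟨g, hg, hg'⟩ := h'.exists_of_mem _ hmem le_rfl
    have := hmin' g hg
    omega
  have hcard := h.card_le
  have c2 := cnt 2
  rw [if_neg (by omega), if_neg (by omega), if_pos rfl, hm'2] at c2
  have hfilter : ∀ g ∈ A, (a' g + b' g = s' ∧ (a' g = 1 ∨ b' g = 1)) →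
      g ∈ A.filter fun f => a f + b f = 2 := fun g hg hg' =>
    Finset.mem_filter.2 ⟨hg, ((hM g hg).2 hg').1⟩
  -- For `s' = 3`, `m` has two parts 2, so a third edge `g` lies outside them. In the second forest
  -- its component has size at least 4, as any edge of a 3-vertex component is a leaf edge. Deleting
  -- a leaf edge `l` there yields `m'.count 1 + 1 = m.count 1 + 2` ones, but in the first forest at
  -- most one 1 can be gained.
  by_cases h3 : s' = 3
  · subst h3
    simp only [Nat.reduceSub, if_true] at c2
    have hne : (A.filter fun f => ¬ a f + b f = 2).Nonempty := by
      have := A.card_filter_add_card_filter_not (fun f => a f + b f = 2)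
      rw [← Finset.card_pos]
      omega
    obtain ⟨g, hg⟩ := hne
    obtain ⟨hgA, hg2⟩ := Finset.mem_filter.1 hg
    have hg4 : 4 ≤ a' g + b' g := by
      by_contra hlt4
      have h1 := hmin' g hgA
      have h2 := h'.left_pos g hgA
      have h3 := h'.right_pos g hgA
      exact hg2 ((hM g hgA).2 ⟨by omega, by omega⟩).1
    obtain ⟨l, hl, hlp, hll⟩ := h'.exists_leaf hgA
    have hl2 : a l + b l ≠ 2 := by
      intro h2
      have h3 := h.left_pos l hl
      have h5 := h.right_pos l hl
      have h4 := ((hM l hl).1 ⟨h2, by omega⟩).1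
      omega
    have e3 := congrArg (Multiset.count 1) (h'.split_leaf hl hll)
    have e4 := congrArg (Multiset.count 1) (h.split l hl)
    have c1 := cnt 1
    have := h.left_pos l hl
    have := h.right_pos l hl
    simp only [Multiset.count_add, Multiset.insert_eq_cons, Multiset.count_cons,
      Multiset.count_singleton] at e3 e4
    simp only [Nat.reduceSub, if_true, OfNat.one_ne_ofNat, if_false] at c1
    split_ifs at e3 e4 <;> omega
  -- For `s' ≥ 4`, `m` has a single part 2, but two leaf edges of one component of the second forest
  -- would both be 2-vertex components of the first.
  · obtain ⟨g, hg, l, hl, hne, hg', hl'⟩ := h'.exists_leaves f hf (by omega)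
    rw [hfs'] at hg' hl'
    have := Finset.one_lt_card.2 ⟨g, hfilter g hg hg', l, hfilter l hl hl', hne⟩
    rw [if_neg (by omega)] at c2
    omega

/-- A forest with at least three edges has its component sizes determined by those of all its
edge-deleted subforests. -/
theorem eq (h : IsSplitting A m c a b) (h' : IsSplitting A m' c a' b') (hA : 3 ≤ A.card) :
    m = m' := by
  have hne : A.Nonempty := Finset.card_pos.1 (by omega)
  obtain ⟨s, hs, hmin, hle, hiff, f, hf, hfs, hfl⟩ := h.exists_min hne
  obtain ⟨s', hs', hmin', hle', hiff', f', hf', hfs', hfl'⟩ := h'.exists_min hne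
  -- Both sides describe the maximizers of `(c g).sumSq`, and `c` is common to the two forests.
  have hM : ∀ g ∈ A, a g + b g = s ∧ (a g = 1 ∨ b g = 1) ↔
      a' g + b' g = s' ∧ (a' g = 1 ∨ b' g = 1) := by
    intro g hg
    rw [← hiff g hg, ← hiff' g hg]
    have h1 := (hiff f hf).2 ⟨hfs, hfl⟩
    have h2 := (hiff' f' hf').2 ⟨hfs', hfl'⟩
    have h3 := hle f' hf'
    have h4 := hle' f hf
    omega
  rcases le_total s s' with hss | hss
  · exact h.eq_of_le h' hA hs hss hmin' hM hf hfs hfl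
  · exact (h'.eq_of_le h hA hs' hss hmin (fun g hg => (hM g hg).symm) hf' hfs' hfl').symm

end IsSplitting

/-! ### Trees as systems of splits; components left by deleting edges -/

/-- The combinatorial structure that a tree with vertex set `V` and edge set `E` carries: every
edge `e` splits the vertices into two sides, labelled by booleans, and has one endpoint on each of
them; no other edge separates the two endpoints; for any two edges one of the four intersections of
their sides is empty; and the sides separate the vertices. -/
structure TreeSiding (E V : Type*) where
  side : E → V → Bool
  endpoint : E → Bool → V
  side_endpoint : ∀ e c, side e (endpoint e c) = c
  side_endpoint_of_ne : ∀ e f, f ≠ e → ∀ c d, side f (endpoint e c) = side f (endpoint e d)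
  exists_empty_corner : ∀ e f, e ≠ f → ∃ c d, ∀ v, side e v = c → side f v ≠ d
  ext_of_side : ∀ u v, (∀ e, side e u = side e v) → u = v

namespace TreeSiding

variable {E V : Type*} (χ : TreeSiding E V)

/-- The edge `f` lies on one side of `e`, so it meets both corners there; the empty corner is on the
other side of `e`, which `f` therefore does not cut. -/
theorem side_eq_of_side_ne_endpoint {e f : E} (hef : e ≠ f) {u v : V} {b : Bool}
    (hu : χ.side e u ≠ χ.side e (χ.endpoint f b)) (hv : χ.side e u = χ.side e v) :
    χ.side f u = χ.side f v := by
  obtain ⟨c, d, h⟩ := χ.exists_empty_corner e f hef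
  have h1 := h (χ.endpoint f d)
  rw [χ.side_endpoint, χ.side_endpoint_of_ne f e hef d b] at h1
  have h2 := h u
  have h3 := h v
  revert hu hv h1 h2 h3
  cases χ.side e u <;> cases χ.side e v <;> cases χ.side f u <;> cases χ.side f v <;>
    cases χ.side e (χ.endpoint f b) <;> cases c <;> cases d <;> simp

variable [Fintype V]

/-- The vertices that no edge of `S` separates from `v`. -/
def cutClass (S : Finset E) (v : V) : Finset V :=
  Finset.univ.filter fun w => ∀ e ∈ S, χ.side e v = χ.side e w

variable {χ} in
theorem mem_cutClass {S : Finset E} {v w : V} :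
    w ∈ χ.cutClass S v ↔ ∀ e ∈ S, χ.side e v = χ.side e w := by
  simp [cutClass]

theorem self_mem_cutClass (S : Finset E) (v : V) : v ∈ χ.cutClass S v := by
  simp [cutClass]

theorem cutClass_eq_iff {S : Finset E} {v w : V} :
    χ.cutClass S v = χ.cutClass S w ↔ w ∈ χ.cutClass S v := by
  constructor
  · intro h
    rw [h]
    exact χ.self_mem_cutClass S w
  · intro h
    rw [mem_cutClass] at h
    ext x
    simp only [mem_cutClass]
    exact ⟨fun hx e he => (h e he).symm.trans (hx e he), fun hx e he => (h e he).trans (hx e he)⟩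

variable {χ} in
theorem cutClass_endpoint_eq {S : Finset E} {f : E} (hf : f ∉ S) (c d : Bool) :
    χ.cutClass S (χ.endpoint f c) = χ.cutClass S (χ.endpoint f d) := by
  rw [cutClass_eq_iff, mem_cutClass]
  intro e he
  exact χ.side_endpoint_of_ne f e (ne_of_mem_of_not_mem he hf) c d

/-- The component on side `c` of the edge `f`, when the edges in `S` and `f` are deleted. -/
def half [DecidableEq E] (S : Finset E) (f : E) (c : Bool) : Finset V := χ.cutClass (insert f S) (χ.endpoint f c)

variable {χ} in
theorem endpoint_mem_half [DecidableEq E] {S : Finset E} {f : E} (c : Bool) : χ.endpoint f c ∈ χ.half S f c :=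
  χ.self_mem_cutClass _ _

variable [DecidableEq V]

/-- The vertex sets of the components that are left when the edges in `S` are deleted. -/
def cutClasses (S : Finset E) : Finset (Finset V) := Finset.univ.image (χ.cutClass S)

/-- The sizes of the components that are left when the edges in `S` are deleted. -/
def cutParts (S : Finset E) : Multiset ℕ := (χ.cutClasses S).val.map Finset.card

theorem mem_cutClasses {S : Finset E} {C : Finset V} :
    C ∈ χ.cutClasses S ↔ ∃ v, χ.cutClass S v = C := by
  simp [cutClasses]

theorem mem_cutParts {S : Finset E} {i : ℕ} :
    i ∈ χ.cutParts S ↔ ∃ v, (χ.cutClass S v).card = i := by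
  simp [cutParts, cutClasses]

/-- A component `C` is counted once for each of its `C.card` vertices. -/
theorem sumSq_cutParts (S : Finset E) :
    (χ.cutParts S).sumSq = ∑ v, (χ.cutClass S v).card := by
  have h : (χ.cutParts S).sumSq = ∑ C ∈ χ.cutClasses S, C.card ^ 2 := by
    rw [cutParts, Multiset.sumSq, Multiset.map_map]
    rfl
  rw [h, ← Finset.sum_fiberwise_of_maps_to (s := Finset.univ) (t := χ.cutClasses S)
    (g := χ.cutClass S) (fun v _ => Finset.mem_image_of_mem _ (Finset.mem_univ v))]
  refine Finset.sum_congr rfl fun C hC => ?_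
  obtain ⟨v, rfl⟩ := χ.mem_cutClasses.1 hC
  have : (Finset.univ.filter fun w => χ.cutClass S w = χ.cutClass S v) = χ.cutClass S v := by
    ext w
    simp only [Finset.mem_filter, Finset.mem_univ, true_and]
    rw [eq_comm, cutClass_eq_iff]
  rw [Finset.sum_congr this fun w hw => congrArg Finset.card (χ.cutClass_eq_iff.2 hw).symm,
    Finset.sum_const, smul_eq_mul, sq]

variable [DecidableEq E]

variable {χ} {S : Finset E} {f : E}

theorem mem_half (hf : f ∉ S) (c d : Bool) {w : V} :
    w ∈ χ.half S f c ↔ χ.side f w = c ∧ w ∈ χ.cutClass S (χ.endpoint f d) := by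
  rw [← cutClass_endpoint_eq hf c d, half, mem_cutClass, mem_cutClass, Finset.forall_mem_insert,
    χ.side_endpoint, eq_comm]

theorem half_card_pos (c : Bool) : 0 < (χ.half S f c).card :=
  Finset.card_pos.2 ⟨_, endpoint_mem_half c⟩

theorem half_ne : χ.half S f true ≠ χ.half S f false := by
  intro h
  have h1 : χ.endpoint f true ∈ χ.half S f false := h ▸ endpoint_mem_half true
  rw [half, mem_cutClass] at h1
  simpa [χ.side_endpoint] using h1 f (Finset.mem_insert_self _ _)

theorem half_card_add (hf : f ∉ S) (d : Bool) :
    (χ.half S f true).card + (χ.half S f false).card =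
      (χ.cutClass S (χ.endpoint f d)).card := by
  rw [← Finset.card_filter_add_card_filter_not (s := χ.cutClass S (χ.endpoint f d))
    (fun w => χ.side f w = true)]
  congr 2
  · ext w
    rw [mem_half hf true d, Finset.mem_filter, and_comm]
  · ext w
    rw [mem_half hf false d, Finset.mem_filter, and_comm, Bool.not_eq_true]

theorem cutClass_insert_of_mem {v : V} (hf : f ∉ S)
    (hv : v ∈ χ.cutClass S (χ.endpoint f true)) :
    χ.cutClass (insert f S) v = χ.half S f (χ.side f v) := by
  rw [half, eq_comm, cutClass_eq_iff]
  exact (mem_half hf _ true).2 ⟨rfl, hv⟩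

/-- Some edge of `S` separates this component from `f`, and `f` does not cut its far side. -/
theorem cutClass_insert_of_notMem {v : V} (hf : f ∉ S)
    (hv : v ∉ χ.cutClass S (χ.endpoint f true)) :
    χ.cutClass (insert f S) v = χ.cutClass S v := by
  ext w
  rw [mem_cutClass, mem_cutClass, Finset.forall_mem_insert, and_iff_right_iff_imp]
  intro hw
  rw [mem_cutClass] at hv
  push Not at hv
  obtain ⟨e, he, hne⟩ := hv
  exact χ.side_eq_of_side_ne_endpoint (ne_of_mem_of_not_mem he hf) hne.symm (hw e he)

theorem cutClasses_insert (hf : f ∉ S) :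
    χ.cutClasses (insert f S) = insert (χ.half S f true) (insert (χ.half S f false)
      ((χ.cutClasses S).erase (χ.cutClass S (χ.endpoint f true)))) := by
  ext C
  simp only [Finset.mem_insert, Finset.mem_erase, mem_cutClasses]
  constructor
  · rintro ⟨v, rfl⟩
    by_cases hv : v ∈ χ.cutClass S (χ.endpoint f true)
    · rw [cutClass_insert_of_mem hf hv]
      cases χ.side f v <;> simp
    · right; right
      refine ⟨?_, v, (cutClass_insert_of_notMem hf hv).symm⟩
      rw [cutClass_insert_of_notMem hf hv]
      intro h
      exact hv (h ▸ χ.self_mem_cutClass S v)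
  · rintro (rfl | rfl | ⟨h, v, rfl⟩)
    · exact ⟨_, rfl⟩
    · exact ⟨_, rfl⟩
    · refine ⟨v, cutClass_insert_of_notMem hf fun hv => h ?_⟩
      exact (χ.cutClass_eq_iff.2 hv).symm

theorem half_notMem_erase (hf : f ∉ S) (c : Bool) :
    χ.half S f c ∉ (χ.cutClasses S).erase (χ.cutClass S (χ.endpoint f true)) := by
  intro h
  obtain ⟨h1, h2⟩ := Finset.mem_erase.1 h
  obtain ⟨v, hv⟩ := χ.mem_cutClasses.1 h2
  have h3 : χ.endpoint f c ∈ χ.cutClass S v := hv ▸ endpoint_mem_half c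
  rw [← cutClass_eq_iff, hv, cutClass_endpoint_eq hf c true] at h3
  exact h1 h3

theorem cutParts_insert (hf : f ∉ S) :
    χ.cutParts (insert f S) + {(χ.half S f true).card + (χ.half S f false).card} =
      χ.cutParts S + {(χ.half S f true).card, (χ.half S f false).card} := by
  have hmem : χ.cutClass S (χ.endpoint f true) ∈ χ.cutClasses S := χ.mem_cutClasses.2 ⟨_, rfl⟩
  have h1 : χ.cutParts S = (χ.cutClass S (χ.endpoint f true)).card ::ₘ
      ((χ.cutClasses S).erase (χ.cutClass S (χ.endpoint f true))).val.map Finset.card := by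
    rw [cutParts]
    conv_lhs => rw [← Finset.insert_erase hmem]
    rw [Finset.insert_val_of_notMem (Finset.notMem_erase _ _), Multiset.map_cons]
  have h2 : χ.half S f true ∉ insert (χ.half S f false)
      ((χ.cutClasses S).erase (χ.cutClass S (χ.endpoint f true))) := by
    rw [Finset.mem_insert]
    exact fun h => h.elim half_ne (half_notMem_erase hf true)
  rw [h1, cutParts, cutClasses_insert hf, Finset.insert_val_of_notMem h2,
    Finset.insert_val_of_notMem (half_notMem_erase hf false), half_card_add hf true]
  simp only [Multiset.map_cons, Multiset.insert_eq_cons]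
  simp only [← Multiset.singleton_add]
  abel

/-- A leaf edge is found beyond `f` by descent: a half with two vertices contains an edge separating
them, and one half of that edge is strictly smaller. -/
theorem exists_half_card_eq_one (c : Bool) (hf : f ∉ S) :
    ∃ g ∉ S, ∃ d, (χ.half S g d).card = 1 ∧ χ.half S g d ⊆ χ.half S f c ∧
      χ.cutClass S (χ.endpoint g true) = χ.cutClass S (χ.endpoint f true) := by
  induction hn : (χ.half S f c).card using Nat.strong_induction_on generalizing f c with
  | _ n ih =>
  subst hn
  rcases (Nat.succ_le_of_lt (half_card_pos (χ := χ) (S := S) (f := f) c)).eq_or_lt with h1 | h1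
  · exact ⟨f, hf, c, h1.symm, subset_rfl, rfl⟩
  obtain ⟨u, hu, v, hv, huv⟩ := Finset.one_lt_card.1 h1
  rw [mem_half hf c true] at hu hv
  obtain ⟨g, hg⟩ : ∃ g, χ.side g u ≠ χ.side g v := by
    by_contra! h
    exact huv (χ.ext_of_side u v h)
  have huC := mem_cutClass.1 hu.2
  have hvC := mem_cutClass.1 hv.2
  have hgS : g ∉ S := fun h => hg ((huC g h).symm.trans (hvC g h))
  have hgf : g ≠ f := by
    rintro rfl
    exact hg (hu.1.trans hv.1.symm)
  obtain ⟨d, b, hdb⟩ := χ.exists_empty_corner g f hgf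
  -- Both corners on side `c` of `f` are occupied, by `u` and `v`; hence side `d` of `g` lies within
  -- side `c` of `f`.
  have hb : b = !c := by
    by_contra hb
    have hb : b = c := by cases b <;> cases c <;> simp_all
    subst hb
    have h2 := hdb u
    have h3 := hdb v
    revert hg h2 h3
    rw [hu.1, hv.1]
    cases χ.side g u <;> cases χ.side g v <;> cases d <;> simp
  have hclass : χ.cutClass S (χ.endpoint g true) = χ.cutClass S (χ.endpoint f true) := by
    have : χ.cutClass S u = χ.cutClass S (χ.endpoint g true) := by
      rw [cutClass_eq_iff, mem_cutClass]
      intro e he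
      by_contra hne
      exact hg (χ.side_eq_of_side_ne_endpoint (ne_of_mem_of_not_mem he hgS) hne
        ((huC e he).symm.trans (hvC e he)))
    rw [← this, eq_comm, cutClass_eq_iff]
    exact hu.2
  have hsub : χ.half S g d ⊆ χ.half S f c := by
    intro w hw
    rw [mem_half hgS d true, hclass] at hw
    rw [mem_half hf c true]
    refine ⟨?_, hw.2⟩
    have := hdb w hw.1
    revert this
    rw [hb]
    cases χ.side f w <;> cases c <;> simp
  have hlt : (χ.half S g d).card < (χ.half S f c).card := by
    refine Finset.card_lt_card (Finset.ssubset_iff_subset_ne.2 ⟨hsub, fun h => hg ?_⟩)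
    have hu' := (mem_half hf c true).2 hu
    have hv' := (mem_half hf c true).2 hv
    rw [← h, mem_half hgS d true] at hu' hv'
    exact hu'.1.trans hv'.1.symm
  obtain ⟨l, hl, a, ha, hla, hlC⟩ := ih _ hlt d hgS rfl
  exact ⟨l, hl, a, ha, hla.trans hsub, hlC.trans hclass⟩

theorem isSplitting [Fintype E] (χ : TreeSiding E V) (S : Finset E) :
    IsSplitting Sᶜ (χ.cutParts S) (fun f => χ.cutParts (insert f S))
      (fun f => (χ.half S f true).card) (fun f => (χ.half S f false).card) where
  zero_notMem := by
    rw [mem_cutParts]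
    rintro ⟨v, hv⟩
    rw [Finset.card_eq_zero] at hv
    simpa [hv] using χ.self_mem_cutClass S v
  left_pos f _ := half_card_pos true
  right_pos f _ := half_card_pos false
  split f hf := cutParts_insert (Finset.mem_compl.1 hf)
  exists_of_mem p hp h2 := by
    obtain ⟨v, rfl⟩ := χ.mem_cutParts.1 hp
    obtain ⟨w, hw, hne⟩ := Finset.exists_mem_ne h2 v
    obtain ⟨g, hg⟩ : ∃ g, χ.side g v ≠ χ.side g w := by
      by_contra! h
      exact hne (χ.ext_of_side v w h).symm
    have hwC := mem_cutClass.1 hw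
    have hgS : g ∉ S := fun h => hg (hwC g h)
    refine ⟨g, Finset.mem_compl.2 hgS, ?_⟩
    rw [half_card_add hgS true]
    congr 1
    rw [eq_comm, cutClass_eq_iff, mem_cutClass]
    intro e he
    by_contra h
    exact hg (χ.side_eq_of_side_ne_endpoint (ne_of_mem_of_not_mem he hgS) h (hwC e he))
  exists_leaves f hf h3 := by
    have hf := Finset.mem_compl.1 hf
    rw [half_card_add hf true] at h3 ⊢
    obtain ⟨g, hg, c, hgc, hgsub, hgC⟩ := exists_half_card_eq_one (χ := χ) true hf
    obtain ⟨h, hh, d, hhd, hhsub, hhC⟩ := exists_half_card_eq_one (χ := χ) false hf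
    refine ⟨g, Finset.mem_compl.2 hg, h, Finset.mem_compl.2 hh, ?_, ⟨?_, ?_⟩, ⟨?_, ?_⟩⟩
    · rintro rfl
      have hcd : c ≠ d := by
        rintro rfl
        have h1 := hgsub (endpoint_mem_half c)
        have h2 := hhsub (endpoint_mem_half c)
        rw [mem_half hf _ true] at h1 h2
        simpa using h1.1.symm.trans h2.1
      have h4 := half_card_add (χ := χ) hg true
      rw [hgC] at h4
      cases c <;> cases d <;> first | exact hcd rfl | omega
    · rw [half_card_add hg true, hgC]
    · cases c <;> simp [hgc]
    · rw [half_card_add hh true, hhC]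
    · cases d <;> simp [hhd]
  card_le := by
    set F := Sᶜ.filter fun f => (χ.half S f true).card + (χ.half S f false).card = 2 with hF
    have hmem : ∀ f ∈ F, f ∉ S ∧ (χ.cutClass S (χ.endpoint f true)).card = 2 := by
      intro f hf
      obtain ⟨h1, h2⟩ := Finset.mem_filter.1 hf
      rw [Finset.mem_compl] at h1
      rw [half_card_add h1 true] at h2
      exact ⟨h1, h2⟩
    have hcount : (χ.cutParts S).count 2 = ((χ.cutClasses S).filter fun C => C.card = 2).card := by
      rw [cutParts, Multiset.count_map, ← Finset.filter_val, Finset.card_val]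
      simp only [eq_comm]
    rw [hcount]
    -- A two-vertex component holds one edge only: its vertices are the endpoints of `g`, which no
    -- other edge `f` separates.
    refine Finset.card_le_card_of_injOn (fun f => χ.cutClass S (χ.endpoint f true)) ?_ ?_
    · intro f hf
      simp only [Finset.coe_filter, Set.mem_ofPred_eq, mem_cutClasses]
      exact ⟨⟨_, rfl⟩, (hmem f hf).2⟩
    · intro f hf g hg hfg
      by_contra hne
      obtain ⟨hfS, hf2⟩ := hmem f hf
      obtain ⟨hgS, hg2⟩ := hmem g hg
      simp only at hfg
      have hpair : {χ.endpoint g true, χ.endpoint g false} =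
          χ.cutClass S (χ.endpoint f true) := by
        refine Finset.eq_of_subset_of_card_le ?_ ?_
        · rw [hfg]
          intro w hw
          rcases Finset.mem_insert.1 hw with rfl | hw
          · exact χ.self_mem_cutClass _ _
          · rw [Finset.mem_singleton.1 hw, cutClass_endpoint_eq hgS true false]
            exact χ.self_mem_cutClass _ _
        · rw [hf2, Finset.card_pair]
          intro h
          have := congrArg (χ.side g) h
          simp [χ.side_endpoint] at this
      have h1 : ∀ c, χ.endpoint f c ∈ ({χ.endpoint g true, χ.endpoint g false} : Finset V) := by
        intro c
        rw [hpair, cutClass_endpoint_eq hfS true c]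
        exact χ.self_mem_cutClass _ _
      have h2 : ∀ c, χ.side f (χ.endpoint f c) = χ.side f (χ.endpoint g true) := by
        intro c
        have := h1 c
        rw [Finset.mem_insert, Finset.mem_singleton] at this
        rcases this with h | h <;> rw [h]
        exact χ.side_endpoint_of_ne g f hne false true
      have := (h2 true).trans (h2 false).symm
      simp [χ.side_endpoint] at this

/-- Cut sizes for sets of `k` edges determine those for sets of fewer edges, as long as at least
two edges remain. -/
theorem cutParts_eq_of_card_le [Fintype E] {W : Type*} [Fintype W] [DecidableEq W]
    (χ : TreeSiding E V) (χ' : TreeSiding E W) {k : ℕ} (hk : k + 2 ≤ Fintype.card E)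
    (h : ∀ S : Finset E, S.card = k → χ.cutParts S = χ'.cutParts S) (S : Finset E)
    (hS : S.card ≤ k) : χ.cutParts S = χ'.cutParts S := by
  induction hn : k - S.card generalizing S with
  | zero => exact h S (by omega)
  | succ n ih =>
    have hs : ∀ f ∈ Sᶜ, χ.cutParts (insert f S) = χ'.cutParts (insert f S) := by
      intro f hf
      have := Finset.card_insert_of_notMem (Finset.mem_compl.1 hf)
      exact ih _ (by omega) (by omega)
    have hsp := χ'.isSplitting S
    -- By induction the multisets left after one more deletion agree, so both splittings can be
    -- stated with the same `c`. At least three edges remain since `S.card < k`.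
    refine (χ.isSplitting S).eq (a' := fun f => (χ'.half S f true).card)
      (b' := fun f => (χ'.half S f false).card) ⟨hsp.zero_notMem, hsp.left_pos, hsp.right_pos,
      ?_, hsp.exists_of_mem, hsp.exists_leaves, hsp.card_le⟩ ?_
    · intro f hf
      rw [hs f hf]
      exact hsp.split f hf
    · rw [Finset.card_compl]
      omega

end TreeSiding

/-! ### Vertices as pairwise meeting choices of sides -/

namespace TreeSiding

variable {E V : Type*}

/-- Exchange the labels of the two sides of every edge `e` for which `δ e` is `true`. -/
def flip (χ : TreeSiding E V) (δ : E → Bool) : TreeSiding E V where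
  side e v := (δ e).xor (χ.side e v)
  endpoint e c := χ.endpoint e ((δ e).xor c)
  side_endpoint e c := by simp [χ.side_endpoint]
  side_endpoint_of_ne e f hfe c d := by rw [χ.side_endpoint_of_ne e f hfe]
  exists_empty_corner e f hef := by
    obtain ⟨c, d, h⟩ := χ.exists_empty_corner e f hef
    refine ⟨(δ e).xor c, (δ f).xor d, fun v => ?_⟩
    simpa using h v
  ext_of_side u v h := χ.ext_of_side u v fun e => by simpa using h e

variable {χ : TreeSiding E V} in
/-- The endpoints of an edge are the only two vertices that it alone separates. -/
theorem endpoint_eq_of_side_eq {e : E} {u v : V} (he : χ.side e u ≠ χ.side e v)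
    (h : ∀ f, f ≠ e → χ.side f u = χ.side f v) : χ.endpoint e (χ.side e u) = u := by
  refine χ.ext_of_side _ _ fun f => ?_
  by_cases hfe : f = e
  · subst hfe
    exact χ.side_endpoint _ _
  · obtain ⟨c, d, hcd⟩ := χ.exists_empty_corner e f (Ne.symm hfe)
    have h1 := hcd (χ.endpoint e c) (χ.side_endpoint _ _)
    rw [χ.side_endpoint_of_ne e f hfe c (χ.side e u)] at h1
    have h2 := hcd u
    have h3 := hcd v
    rw [← h f hfe] at h3
    revert he h1 h2 h3
    cases χ.side e u <;> cases χ.side e v <;> cases χ.side f u <;> cases c <;> cases d <;> simp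

/-- A choice of a side of every edge such that any two of the chosen sides meet comes from a
vertex. -/
theorem exists_side_eq [Finite E] [Fintype V] (χ : TreeSiding E V) (v₀ : V) (o : E → Bool)
    (ho : ∀ e f, e ≠ f → ∃ v, χ.side e v = o e ∧ χ.side f v = o f) :
    ∃ v, ∀ e, χ.side e v = o e := by
  classical
  cases nonempty_fintype E
  let D : V → Finset E := fun v => Finset.univ.filter fun e => χ.side e v ≠ o e
  have memD : ∀ v e, e ∈ D v ↔ χ.side e v ≠ o e := fun v e => by simp [D]
  -- Take `v` violating the fewest choices, and a violated edge `e` whose side containing `v` is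
  -- smallest. Then `v` is an endpoint of `e`, and crossing `e` repairs `e` without affecting any
  -- other edge.
  obtain ⟨v, -, hv⟩ := Finset.univ.exists_min_image (fun v => (D v).card) ⟨v₀, Finset.mem_univ _⟩
  by_contra! hno
  obtain ⟨e₁, he₁⟩ := hno v
  obtain ⟨e, heD, he⟩ := (D v).exists_min_image
    (fun e => (Finset.univ.filter fun w => χ.side e w = χ.side e v).card) ⟨e₁, (memD _ _).2 he₁⟩
  rw [memD] at heD
  have hend : χ.endpoint e (χ.side e v) = v := by
    by_contra hne
    obtain ⟨f, hf⟩ : ∃ f, χ.side f (χ.endpoint e (χ.side e v)) ≠ χ.side f v := by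
      by_contra! h
      exact hne (χ.ext_of_side _ _ h)
    have hfe : f ≠ e := by
      rintro rfl
      exact hf (χ.side_endpoint _ _)
    -- An edge `f` between `v` and `e` has its side of `v` strictly inside that of `e`; as the
    -- chosen sides meet, `f` is violated too, against the choice of `e`.
    obtain ⟨c, d, hcd⟩ := χ.exists_empty_corner e f hfe.symm
    have h1 := hcd (χ.endpoint e c)
    rw [χ.side_endpoint, χ.side_endpoint_of_ne e f hfe c (χ.side e v)] at h1
    have h1 := h1 rfl
    have h2 := hcd v
    have hd : d = χ.side f v := by
      revert hf h1
      cases χ.side f v <;> cases d <;> cases χ.side f (χ.endpoint e (χ.side e v)) <;> simp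
    have hc : c = !χ.side e v := by
      revert h2
      rw [hd]
      cases χ.side e v <;> cases c <;> simp
    obtain ⟨w, hwe, hwf⟩ := ho e f hfe.symm
    have h3 := hcd w
    have hoe : o e = c := by
      revert heD
      rw [hc]
      cases χ.side e v <;> cases o e <;> simp
    rw [hwe, hoe, hwf, hd] at h3
    have hfD : f ∈ D v := (memD _ _).2 fun h => h3 rfl h.symm
    refine (he f hfD).not_gt (Finset.card_lt_card (Finset.ssubset_iff_of_subset ?_ |>.2
      ⟨χ.endpoint e (χ.side e v), ?_, ?_⟩))
    · intro x
      simp only [Finset.mem_filter, Finset.mem_univ, true_and]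
      intro hx
      have h4 := hcd x
      revert h4
      rw [hx, hd, hc]
      cases χ.side e v <;> cases χ.side e x <;> simp
    · simp [χ.side_endpoint]
    · simpa using hf
  have hlt : (D (χ.endpoint e (o e))).card < (D v).card := by
    refine Finset.card_lt_card (Finset.ssubset_iff_of_subset ?_ |>.2 ⟨e, (memD _ _).2 heD, ?_⟩)
    · intro f
      rw [memD, memD]
      intro hf
      by_cases hfe : f = e
      · subst hfe
        exact heD
      · rw [χ.side_endpoint_of_ne e f hfe (o e) (χ.side e v), hend] at hf
        exact hf
    · rw [memD, χ.side_endpoint]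
      simp
  exact (hv _ (Finset.mem_univ _)).not_gt hlt

/-! ### Sides and corners read off from cuts by one, two and three edges -/

variable [Fintype V] (χ : TreeSiding E V)

/-- The number of vertices on side `c` of the edge `e`. -/
def sideCard (e : E) (c : Bool) : ℕ := (Finset.univ.filter fun v => χ.side e v = c).card

/-- The number of vertices on side `c` of the edge `e` and on side `d` of the edge `f`. -/
def cornerCard (e f : E) (c d : Bool) : ℕ :=
  (Finset.univ.filter fun v => χ.side e v = c ∧ χ.side f v = d).card

theorem cornerCard_comm (e f : E) (c d : Bool) : χ.cornerCard e f c d = χ.cornerCard f e d c := by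
  simp only [cornerCard, and_comm]

theorem cornerCard_eq_zero {e f : E} {c d : Bool} :
    χ.cornerCard e f c d = 0 ↔ ∀ v, χ.side e v = c → χ.side f v ≠ d := by
  simp [cornerCard, Finset.filter_eq_empty_iff]

theorem cornerCard_add (e f : E) (c : Bool) :
    χ.cornerCard e f c true + χ.cornerCard e f c false = χ.sideCard e c := by
  rw [sideCard, ← Finset.card_filter_add_card_filter_not (fun v => χ.side f v = true)]
  simp only [Finset.filter_filter, Bool.not_eq_true]
  rfl

theorem cornerCard_add' (e f : E) (d : Bool) :
    χ.cornerCard e f true d + χ.cornerCard e f false d = χ.sideCard f d := by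
  rw [cornerCard_comm, cornerCard_comm χ e f false, cornerCard_add]

theorem sideCard_add (e : E) :
    χ.sideCard e true + χ.sideCard e false = Fintype.card V := by
  rw [← Finset.card_univ, ← Finset.card_filter_add_card_filter_not (fun v => χ.side e v = true)]
  simp only [Bool.not_eq_true]
  rfl

theorem sideCard_flip (δ : E → Bool) (e : E) (c : Bool) :
    (χ.flip δ).sideCard e c = χ.sideCard e ((δ e).xor c) := by
  simp only [sideCard]
  congr 1
  ext v
  rw [Finset.mem_filter, Finset.mem_filter]
  simp only [flip]
  cases δ e <;> cases χ.side e v <;> cases c <;> simp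

theorem cornerCard_flip (δ : E → Bool) (e f : E) (c d : Bool) :
    (χ.flip δ).cornerCard e f c d = χ.cornerCard e f ((δ e).xor c) ((δ f).xor d) := by
  simp only [cornerCard]
  congr 1
  ext v
  rw [Finset.mem_filter, Finset.mem_filter]
  simp only [flip]
  refine and_congr_right fun _ => and_congr ?_ ?_
  · cases δ e <;> cases χ.side e v <;> cases c <;> simp
  · cases δ f <;> cases χ.side f v <;> cases d <;> simp

theorem cutClass_flip (δ : E → Bool) (S : Finset E) (v : V) :
    (χ.flip δ).cutClass S v = χ.cutClass S v := by
  simp [cutClass, flip]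

theorem cutParts_flip [DecidableEq V] (δ : E → Bool) (S : Finset E) :
    (χ.flip δ).cutParts S = χ.cutParts S := by
  have : (χ.flip δ).cutClass S = χ.cutClass S := funext (χ.cutClass_flip δ S)
  rw [cutParts, cutParts, cutClasses, cutClasses, this]

/-- The endpoints of `e` and `f` occupy three corners, so there is no second empty one. -/
theorem exists_cornerCard_eq_zero_iff {e f : E} (hef : e ≠ f) :
    ∃ c d, ∀ a b, χ.cornerCard e f a b = 0 ↔ a = c ∧ b = d := by
  obtain ⟨c, d, h⟩ := χ.exists_empty_corner e f hef
  refine ⟨c, d, fun a b => ⟨fun h0 => ?_, ?_⟩⟩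
  · rw [cornerCard_eq_zero] at h0
    have h1 := h (χ.endpoint e c) (χ.side_endpoint _ _)
    have h2 := h0 (χ.endpoint e a) (χ.side_endpoint _ _)
    have h3 := h (χ.endpoint f d)
    have h4 := h0 (χ.endpoint f b)
    rw [χ.side_endpoint, χ.side_endpoint_of_ne f e hef d b] at h3
    rw [χ.side_endpoint] at h4
    rw [χ.side_endpoint_of_ne e f hef.symm c a] at h1
    revert h1 h2 h3 h4
    cases χ.side f (χ.endpoint e a) <;> cases χ.side e (χ.endpoint f b) <;> cases a <;>
      cases b <;> cases c <;> cases d <;> simp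
  · rintro ⟨rfl, rfl⟩
    exact χ.cornerCard_eq_zero.2 h

theorem sumSq_cutParts_singleton [DecidableEq V] (e : E) :
    (χ.cutParts {e}).sumSq = χ.sideCard e true ^ 2 + χ.sideCard e false ^ 2 := by
  have h : ∀ v, (χ.cutClass {e} v).card = χ.sideCard e (χ.side e v) := fun v => by
    rw [sideCard]
    congr 1
    ext w
    simp [mem_cutClass, eq_comm]
  rw [sumSq_cutParts, Finset.sum_congr rfl fun v _ => h v,
    ← Finset.sum_fiberwise Finset.univ (χ.side e), Fintype.sum_bool]
  congr 1 <;>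
  · rw [Finset.sum_congr rfl fun v hv => congrArg _ (Finset.mem_filter.1 hv).2, Finset.sum_const,
      smul_eq_mul, sq]
    rfl

theorem sumSq_cutParts_pair [DecidableEq V] [DecidableEq E] (e f : E) :
    (χ.cutParts {e, f}).sumSq = χ.cornerCard e f true true ^ 2 + χ.cornerCard e f true false ^ 2 +
      (χ.cornerCard e f false true ^ 2 + χ.cornerCard e f false false ^ 2) := by
  have h : ∀ v, (χ.cutClass {e, f} v).card = χ.cornerCard e f (χ.side e v) (χ.side f v) :=
    fun v => by
      rw [cornerCard]
      congr 1
      ext w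
      rw [mem_cutClass, Finset.forall_mem_insert]
      simp [eq_comm]
  rw [sumSq_cutParts, Finset.sum_congr rfl fun v _ => h v,
    ← Finset.sum_fiberwise Finset.univ (fun v => (χ.side e v, χ.side f v)), Fintype.sum_prod_type,
    Fintype.sum_bool, Fintype.sum_bool, Fintype.sum_bool]
  congr 2 <;>
  · rw [Finset.sum_congr rfl fun v hv => congrArg₂ _ (Prod.mk.inj (Finset.mem_filter.1 hv).2).1
      (Prod.mk.inj (Finset.mem_filter.1 hv).2).2, Finset.sum_const, smul_eq_mul, sq]
    simp only [cornerCard, Prod.mk.injEq]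

theorem exists_flip_sideCard_le :
    ∃ δ : E → Bool, ∀ e, 2 * (χ.flip δ).sideCard e true ≤ Fintype.card V := by
  refine ⟨fun e => decide (Fintype.card V < 2 * χ.sideCard e true), fun e => ?_⟩
  rw [sideCard_flip]
  have := χ.sideCard_add e
  by_cases h : Fintype.card V < 2 * χ.sideCard e true
  · simp only [h, decide_true, Bool.xor_true, Bool.not_true]
    omega
  · simp only [h, decide_false, Bool.xor_true, Bool.not_false]
    omega

variable {χ}

/-- An edge whose sides have equal size is met by one side only of any other edge `f`: it separates
the smaller side of `f` from one half of the vertices. -/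
theorem exists_cornerCard_eq_zero_iff_of_central {e f : E} (hef : e ≠ f)
    (he : 2 * χ.sideCard e true = Fintype.card V) (hf : 2 * χ.sideCard f true ≤ Fintype.card V) :
    ∃ c, ∀ a b, χ.cornerCard e f a b = 0 ↔ a = c ∧ b = true := by
  obtain ⟨c, d, h⟩ := χ.exists_cornerCard_eq_zero_iff hef
  refine ⟨c, ?_⟩
  -- Otherwise half `c` lies in the smaller side of `f`, hence equals it by size, and a second
  -- corner is empty.
  have hd : d = true := by
    have h1 := χ.cornerCard_add e f c
    have h2 := χ.cornerCard_add' e f d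
    have h3 := χ.cornerCard_add' e f (!d)
    have h4 := χ.sideCard_add e
    have h5 := χ.sideCard_add f
    have h6 := (h c d).2 ⟨rfl, rfl⟩
    have h7 := h (!c) (!d)
    cases d
    · exfalso
      cases c <;> simp at h7 h3 h1 h2 h6 <;> omega
    · rfl
  subst hd
  exact h

theorem sideCard_lt_of_central {e f : E} (hef : e ≠ f)
    (he : 2 * χ.sideCard e true = Fintype.card V) (hf : 2 * χ.sideCard f true ≤ Fintype.card V) :
    2 * χ.sideCard f true < Fintype.card V := by
  obtain ⟨c, h⟩ := exists_cornerCard_eq_zero_iff_of_central hef he hf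
  have h1 := χ.cornerCard_add e f (!c)
  have h2 := χ.cornerCard_add' e f true
  have h4 := χ.sideCard_add e
  have h6 := (h c true).2 ⟨rfl, rfl⟩
  have h7 := h (!c) false
  cases c <;> simp at h7 h1 h2 h6 <;> omega

/-- The value 0 means disjoint smaller sides, the minimum means nested ones. The two sums of squares
differ by `2 * min p q * (n - 2 * max p q)`, which would vanish for a side of size `n / 2`; hence
the strict bounds. -/
theorem cornerCard_eq_of_sumSq_eq {n p q x y : ℕ} (hp : 2 * p < n) (hq : 2 * q < n)
    (hx : x = 0 ∨ x = min p q) (hy : y = 0 ∨ y = min p q)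
    (h : x ^ 2 + (p - x) ^ 2 + ((q - x) ^ 2 + (n - p - (q - x)) ^ 2) =
      y ^ 2 + (p - y) ^ 2 + ((q - y) ^ 2 + (n - p - (q - y)) ^ 2)) : x = y := by
  have key : ∀ p q m : ℕ, 2 * p < n → 2 * q < n → m = min p q →
      0 ^ 2 + (p - 0) ^ 2 + ((q - 0) ^ 2 + (n - p - (q - 0)) ^ 2) =
        m ^ 2 + (p - m) ^ 2 + ((q - m) ^ 2 + (n - p - (q - m)) ^ 2) → 0 = m := by
    intro p q m hp hq hm h
    obtain ⟨r, hr⟩ : ∃ r, n = p + q + r := ⟨n - p - q, by omega⟩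
    subst hr
    have e1 : p + q + r - p - (q - 0) = r := by omega
    have e2 : p + q + r - p - (q - m) = r + m := by omega
    rw [e1, e2] at h
    rcases le_total p q with hpq | hpq
    · obtain ⟨t, rfl⟩ := Nat.exists_eq_add_of_le hpq
      have : m = p := by omega
      subst this
      simp only [Nat.sub_zero, Nat.sub_self, Nat.add_sub_cancel_left] at h
      have h3 : t < r := by omega
      by_contra hne
      have : 0 < m * (r - t) := Nat.mul_pos (by omega) (by omega)
      obtain ⟨s, rfl⟩ := Nat.exists_eq_add_of_lt h3
      have : 0 < m := by omega
      nlinarith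
    · obtain ⟨t, rfl⟩ := Nat.exists_eq_add_of_le hpq
      have : m = q := by omega
      subst this
      simp only [Nat.sub_zero, Nat.sub_self, Nat.add_sub_cancel_left] at h
      have h3 : t < r := by omega
      by_contra hne
      obtain ⟨s, rfl⟩ := Nat.exists_eq_add_of_lt h3
      have : 0 < m := by omega
      nlinarith
  rcases hx with rfl | hx <;> rcases hy with rfl | hy
  · rfl
  · exact key p q y hp hq hy h
  · exact (key p q x hp hq hx h.symm).symm
  · omega

theorem cornerCard_true_true {e f : E} (hef : e ≠ f)
    (he : 2 * χ.sideCard e true < Fintype.card V) (hf : 2 * χ.sideCard f true < Fintype.card V) :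
    χ.cornerCard e f true true = 0 ∨
      χ.cornerCard e f true true = min (χ.sideCard e true) (χ.sideCard f true) := by
  obtain ⟨c, d, h⟩ := χ.exists_cornerCard_eq_zero_iff hef
  have h0 := (h c d).2 ⟨rfl, rfl⟩
  have h1 := χ.cornerCard_add e f true
  have h2 := χ.cornerCard_add' e f true
  have h3 := χ.cornerCard_add e f false
  have h4 := χ.sideCard_add e
  cases c <;> cases d <;> omega

theorem cornerCard_eq [DecidableEq V] [DecidableEq E] {W : Type*} [Fintype W] [DecidableEq W]
    {χ' : TreeSiding E W} (hVW : Fintype.card V = Fintype.card W) {e f : E} (hef : e ≠ f)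
    (he : 2 * χ.sideCard e true < Fintype.card V) (hf : 2 * χ.sideCard f true < Fintype.card V)
    (hse : χ.sideCard e true = χ'.sideCard e true) (hsf : χ.sideCard f true = χ'.sideCard f true)
    (h : χ.cutParts {e, f} = χ'.cutParts {e, f}) (c d : Bool) :
    χ.cornerCard e f c d = χ'.cornerCard e f c d := by
  have hq := congrArg Multiset.sumSq h
  rw [sumSq_cutParts_pair, sumSq_cutParts_pair] at hq
  have hx := cornerCard_true_true hef he hf
  have hy := cornerCard_true_true (χ := χ') hef (by omega) (by omega)
  rw [← hse, ← hsf] at hy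
  have a1 := χ.cornerCard_add e f true
  have a2 := χ.cornerCard_add' e f true
  have a3 := χ.cornerCard_add e f false
  have a4 := χ.sideCard_add e
  have b1 := χ'.cornerCard_add e f true
  have b2 := χ'.cornerCard_add' e f true
  have b3 := χ'.cornerCard_add e f false
  have b4 := χ'.sideCard_add e
  have e1 : χ.cornerCard e f true false = χ.sideCard e true - χ.cornerCard e f true true := by
    omega
  have e2 : χ.cornerCard e f false true = χ.sideCard f true - χ.cornerCard e f true true := by
    omega
  have e3 : χ.cornerCard e f false false = Fintype.card V - χ.sideCard e true -
      (χ.sideCard f true - χ.cornerCard e f true true) := by omega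
  have e4 : χ'.cornerCard e f true false = χ.sideCard e true - χ'.cornerCard e f true true := by
    omega
  have e5 : χ'.cornerCard e f false true = χ.sideCard f true - χ'.cornerCard e f true true := by
    omega
  have e6 : χ'.cornerCard e f false false = Fintype.card V - χ.sideCard e true -
      (χ.sideCard f true - χ'.cornerCard e f true true) := by omega
  rw [e1, e2, e3, e4, e5, e6] at hq
  have := cornerCard_eq_of_sumSq_eq he hf hx hy hq
  cases c <;> cases d <;> omega

theorem sideCard_eq [DecidableEq V] {W : Type*} [Fintype W] [DecidableEq W]
    {χ' : TreeSiding E W} (hVW : Fintype.card V = Fintype.card W) {e : E}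
    (he : 2 * χ.sideCard e true ≤ Fintype.card V) (he' : 2 * χ'.sideCard e true ≤ Fintype.card W)
    (h : χ.cutParts {e} = χ'.cutParts {e}) : χ.sideCard e true = χ'.sideCard e true := by
  have hq := congrArg Multiset.sumSq h
  rw [sumSq_cutParts_singleton, sumSq_cutParts_singleton] at hq
  have h1 := χ.sideCard_add e
  have h2 := χ'.sideCard_add e
  rcases lt_trichotomy (χ.sideCard e true) (χ'.sideCard e true) with hlt | heq | hlt
  · nlinarith
  · exact heq
  · nlinarith

/-- Two edges lie on the same side of an edge with sides of equal size if and only if that size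
occurs among the component sizes when the three edges are deleted. -/
theorem mem_cutParts_iff_of_central [DecidableEq V] [DecidableEq E] {e f g : E} {c d : Bool}
    (he : 2 * χ.sideCard e true = Fintype.card V)
    (hf : ∀ a b, χ.cornerCard e f a b = 0 ↔ a = c ∧ b = true)
    (hg : ∀ a b, χ.cornerCard e g a b = 0 ↔ a = d ∧ b = true) :
    χ.sideCard e true ∈ χ.cutParts {e, f, g} ↔ c = d := by
  have hcard : ∀ a, χ.sideCard e a = χ.sideCard e true := by
    have := χ.sideCard_add e
    intro a
    cases a <;> omega
  rw [mem_cutParts]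
  constructor
  · rintro ⟨v, hv⟩
    by_contra hcd
    -- An edge `l` that cuts the half of `v` makes its component smaller than `n / 2`; when `c ≠ d`,
    -- each half is cut by `f` or `g`.
    have key : ∀ l ∈ ({e, f, g} : Finset E), (∀ b, χ.cornerCard e l (χ.side e v) b ≠ 0) → False := by
      intro l hl h
      have h1 : (χ.cutClass {e, f, g} v).card ≤
          χ.cornerCard e l (χ.side e v) (χ.side l v) := by
        refine Finset.card_le_card fun w hw => ?_
        rw [mem_cutClass] at hw
        rw [Finset.mem_filter]
        exact ⟨Finset.mem_univ _, (hw e (by simp)).symm, (hw l hl).symm⟩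
      have h2 := χ.cornerCard_add e l (χ.side e v)
      have h3 := h (!χ.side l v)
      rw [hcard] at h2
      cases hl : χ.side l v <;> simp only [hl, Bool.not_true, Bool.not_false] at h1 h3 <;> omega
    by_cases hvc : χ.side e v = c
    · exact key g (by simp) fun b hb => hcd (hvc.symm.trans ((hg _ _).1 hb).1)
    · exact key f (by simp) fun b hb => hvc ((hf _ _).1 hb).1
  · rintro rfl
    refine ⟨χ.endpoint e c, ?_⟩
    rw [← hcard c, sideCard]
    congr 1
    have h1 := χ.cornerCard_eq_zero.1 ((hf c true).2 ⟨rfl, rfl⟩)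
    have h2 := χ.cornerCard_eq_zero.1 ((hg c true).2 ⟨rfl, rfl⟩)
    ext w
    simp only [mem_cutClass, Finset.mem_insert, Finset.mem_singleton, forall_eq_or_imp, forall_eq,
      χ.side_endpoint, Finset.mem_filter, Finset.mem_univ, true_and]
    constructor
    · exact fun h => h.1.symm
    · intro h
      have a1 := h1 _ h
      have a2 := h2 _ h
      have a3 := h1 _ (χ.side_endpoint e c)
      have a4 := h2 _ (χ.side_endpoint e c)
      rw [ne_eq, Bool.not_eq_true] at a1 a2 a3 a4
      rw [a1, a2, a3, a4]
      exact ⟨h.symm, rfl, rfl⟩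

/-! ### Matching two split systems -/

variable {W : Type*} [Fintype W] {χ' : TreeSiding E W}

/-- Without a central edge, smaller sides orient all edges canonically and no flip is needed.
Otherwise only the central edge `z` may need one. -/
theorem exists_flip_cornerCard [DecidableEq V] [DecidableEq E] [DecidableEq W]
    (hVW : Fintype.card V = Fintype.card W)
    (hχ : ∀ e, 2 * χ.sideCard e true ≤ Fintype.card V)
    (hχ' : ∀ e, 2 * χ'.sideCard e true ≤ Fintype.card W)
    (h : ∀ S : Finset E, S.card ≤ 3 → χ.cutParts S = χ'.cutParts S) :
    ∃ δ : E → Bool, ∀ e f, e ≠ f → ∀ c d,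
      χ.cornerCard e f c d = 0 ↔ (χ'.flip δ).cornerCard e f c d = 0 := by
  have hs : ∀ e, χ.sideCard e true = χ'.sideCard e true := fun e =>
    sideCard_eq hVW (hχ e) (hχ' e) (h _ (by simp))
  by_cases hcen : ∃ e, 2 * χ.sideCard e true = Fintype.card V
  swap
  · push Not at hcen
    refine ⟨fun _ => false, fun e f hef c d => ?_⟩
    rw [cornerCard_flip, Bool.false_xor, Bool.false_xor,
      cornerCard_eq hVW hef ((hχ e).lt_of_ne (hcen e)) ((hχ f).lt_of_ne (hcen f)) (hs e) (hs f)
        (h _ (Finset.card_le_two.trans (by norm_num)))]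
  obtain ⟨z, hz⟩ := hcen
  have hz' : 2 * χ'.sideCard z true = Fintype.card W := by rw [← hs, hz, hVW]
  choose c hc using fun (f : E) (hf : z ≠ f) =>
    exists_cornerCard_eq_zero_iff_of_central hf hz (hχ f)
  choose c' hc' using fun (f : E) (hf : z ≠ f) =>
    exists_cornerCard_eq_zero_iff_of_central hf hz' (hχ' f)
  have hcc : ∀ f (hf : z ≠ f) g (hg : z ≠ g), c f hf = c g hg ↔ c' f hf = c' g hg := by
    intro f hf g hg
    rw [← mem_cutParts_iff_of_central hz (hc f hf) (hc g hg),
      ← mem_cutParts_iff_of_central hz' (hc' f hf) (hc' g hg), h _ Finset.card_le_three, hs]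
  -- Both trees group the other edges alike into two halves of `z`, so the labellings of the halves
  -- agree up to one global exchange `t`.
  obtain ⟨t, ht⟩ : ∃ t : Bool, ∀ f hf, c' f hf = t.xor (c f hf) := by
    by_cases hex : ∃ f, z ≠ f
    · obtain ⟨f, hf⟩ := hex
      refine ⟨(c' f hf).xor (c f hf), fun g hg => ?_⟩
      have := hcc f hf g hg
      revert this
      cases c f hf <;> cases c' f hf <;> cases c g hg <;> cases c' g hg <;> simp
    · push Not at hex
      exact ⟨false, fun f hf => absurd (hex f) hf⟩
  have hzf : ∀ f, z ≠ f → ∀ a b, χ.cornerCard z f a b = 0 ↔ χ'.cornerCard z f (t.xor a) b = 0 := by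
    intro f hf a b
    rw [hc f hf, hc' f hf, ht]
    simp
  refine ⟨fun e => if e = z then t else false, fun e f hef a b => ?_⟩
  rw [cornerCard_flip]
  by_cases hez : e = z
  · subst hez
    rw [if_pos rfl, if_neg hef.symm, Bool.false_xor]
    exact hzf f hef a b
  by_cases hfz : f = z
  · subst hfz
    rw [if_pos rfl, if_neg hef, Bool.false_xor, cornerCard_comm, cornerCard_comm χ']
    exact hzf e hef.symm b a
  rw [if_neg hez, if_neg hfz, Bool.false_xor, Bool.false_xor,
    cornerCard_eq hVW hef (sideCard_lt_of_central (Ne.symm hez) hz (hχ e))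
      (sideCard_lt_of_central (Ne.symm hfz) hz (hχ f)) (hs e) (hs f)
      (h _ (Finset.card_le_two.trans (by norm_num)))]

/-- The sides of a vertex `v` meet pairwise, hence so do the like-labelled sides in the second
system, and they come from a vertex there. -/
theorem exists_equiv_of_cornerCard [Finite E] (hVW : Fintype.card V = Fintype.card W)
    (hne : ∀ e f, e ≠ f → ∀ c d, χ.cornerCard e f c d = 0 ↔ χ'.cornerCard e f c d = 0) :
    ∃ φ : V ≃ W, ∀ e v, χ'.side e (φ v) = χ.side e v := by
  have hex : ∀ v, ∃ w, ∀ e, χ'.side e w = χ.side e v := by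
    intro v
    have hW : 0 < Fintype.card W := hVW ▸ Fintype.card_pos_iff.2 ⟨v⟩
    obtain ⟨w₀⟩ := Fintype.card_pos_iff.1 hW
    refine χ'.exists_side_eq w₀ _ fun e f hef => ?_
    by_contra! h
    have := (hne e f hef _ _).2 (χ'.cornerCard_eq_zero.2 h)
    exact χ.cornerCard_eq_zero.1 this v rfl rfl
  choose φ hφ using hex
  have hinj : Function.Injective φ := fun u v huv =>
    χ.ext_of_side u v fun e => by rw [← hφ, ← hφ, huv]
  exact ⟨Equiv.ofBijective φ ((Fintype.bijective_iff_injective_and_card φ).2 ⟨hinj, hVW⟩),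
    fun e v => hφ v e⟩

/-- Component sizes after deletion of at most three edges determine which edges separate which
vertices. -/
theorem exists_equiv [Finite E] [DecidableEq V] [DecidableEq E] [DecidableEq W]
    (hVW : Fintype.card V = Fintype.card W)
    (h : ∀ S : Finset E, S.card ≤ 3 → χ.cutParts S = χ'.cutParts S) :
    ∃ φ : V ≃ W, ∀ e u v, χ'.side e (φ u) = χ'.side e (φ v) ↔ χ.side e u = χ.side e v := by
  obtain ⟨δ, hδ⟩ := χ.exists_flip_sideCard_le
  obtain ⟨δ', hδ'⟩ := χ'.exists_flip_sideCard_le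
  obtain ⟨ε, hε⟩ := exists_flip_cornerCard hVW hδ hδ' fun S hS => by
    rw [cutParts_flip, cutParts_flip, h S hS]
  obtain ⟨φ, hφ⟩ := exists_equiv_of_cornerCard hVW hε
  refine ⟨φ, fun e u v => ?_⟩
  have h1 := hφ e u
  have h2 := hφ e v
  simp only [flip] at h1 h2
  revert h1 h2
  cases ε e <;> cases δ e <;> cases δ' e <;> cases χ'.side e (φ u) <;>
    cases χ'.side e (φ v) <;> cases χ.side e u <;> cases χ.side e v <;> simp

end TreeSiding

/-! ### The split system of a tree -/

namespace SimpleGraph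

variable {V : Type*} {T : SimpleGraph V}

/-- The path from `u` to `v` is unique, so it survives the deletion of `s` once it survives that of
each edge of `s`. -/
theorem IsAcyclic.reachable_deleteEdges_iff (hT : T.IsAcyclic) {s : Set (Sym2 V)} {u v : V} :
    (T.deleteEdges s).Reachable u v ↔
      T.Reachable u v ∧ ∀ e ∈ s, (T.deleteEdges {e}).Reachable u v := by
  classical
  constructor
  · exact fun h => ⟨h.mono (T.deleteEdges_le s), fun e he =>
      h.mono (deleteEdges_anti (Set.singleton_subset_iff.2 he))⟩
  · rintro ⟨⟨p⟩, h⟩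
    refine ⟨(p.toPath : T.Walk u v).toDeleteEdges s fun e he hes => ?_⟩
    obtain ⟨q⟩ := h e hes
    have hq : (q.toPath : (T.deleteEdges {e}).Walk u v).edges = (p.toPath : T.Walk u v).edges := by
      rw [(hT.subsingleton_path u v).elim p.toPath ⟨_, q.toPath.2.mapLe (T.deleteEdges_le {e})⟩,
        Walk.edges_mapLe_eq_edges]
    rw [← hq] at he
    have := Walk.edges_subset_edgeSet _ he
    simp at this

theorem Connected.reachable_deleteEdges_or (hT : T.Connected) (a b v : V) :
    (T.deleteEdges {s(a, b)}).Reachable a v ∨ (T.deleteEdges {s(a, b)}).Reachable b v := by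
  have key : ∀ {u w : V} (p : T.Walk u w), u = a →
      (T.deleteEdges {s(a, b)}).Reachable a w ∨ (T.deleteEdges {s(a, b)}).Reachable b w := by
    intro u w p hu
    induction p using Walk.concatRec with
    | Hnil => exact Or.inl (hu ▸ .rfl)
    | @Hconcat x y z p h ih =>
      by_cases he : s(y, z) = s(a, b)
      · rcases Sym2.eq_iff.1 he with ⟨-, rfl⟩ | ⟨-, rfl⟩
        · exact Or.inr .rfl
        · exact Or.inl .rfl
      · have hadj : (T.deleteEdges {s(a, b)}).Adj y z := by
          rw [deleteEdges_adj]
          exact ⟨h, he⟩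
        exact (ih hu).imp (fun h' => h'.trans hadj.reachable) fun h' => h'.trans hadj.reachable
  obtain ⟨p⟩ := hT.preconnected a v
  exact key p rfl

theorem exists_adj_of_reachable_of_ne {α : Type*} {G : SimpleGraph V} {u v : V}
    (h : G.Reachable u v) {g : V → α} (hg : g u ≠ g v) :
    ∃ x y, G.Reachable u x ∧ G.Adj x y ∧ g x ≠ g y := by
  obtain ⟨p⟩ := h
  induction p with
  | nil => exact absurd rfl hg
  | @cons u w v h p ih =>
    by_cases huw : g u = g w
    · obtain ⟨x, y, hx, hxy, hne⟩ := ih (huw ▸ hg)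
      exact ⟨x, y, h.reachable.trans hx, hxy, hne⟩
    · exact ⟨u, w, .rfl, h, huw⟩

theorem mk_out_edge (e : T.edgeSet) : s(e.1.out.1, e.1.out.2) = e.1 := Quot.out_eq e.1

open Classical in
/-- Whether the vertex `v` is on the side of the first endpoint of the edge `e`. -/
noncomputable def edgeSide (e : T.edgeSet) (v : V) : Bool :=
  decide ((T.deleteEdges {e.1}).Reachable e.1.out.1 v)

/-- The two endpoints of an edge, in an arbitrary order. -/
noncomputable def edgeEndpoint (e : T.edgeSet) (c : Bool) : V :=
  if c then e.1.out.1 else e.1.out.2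

theorem mk_edgeEndpoint (e : T.edgeSet) (c : Bool) :
    s(edgeEndpoint e c, edgeEndpoint e (!c)) = e.1 := by
  cases c
  · rw [Sym2.eq_swap]
    exact mk_out_edge e
  · exact mk_out_edge e

theorem IsTree.edgeSide_eq_iff (hT : T.IsTree) {e : T.edgeSet} {u v : V} :
    edgeSide e u = edgeSide e v ↔ (T.deleteEdges {e.1}).Reachable u v := by
  classical
  simp only [edgeSide, decide_eq_decide]
  have h1 := hT.connected.reachable_deleteEdges_or e.1.out.1 e.1.out.2 u
  have h2 := hT.connected.reachable_deleteEdges_or e.1.out.1 e.1.out.2 v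
  rw [mk_out_edge] at h1 h2
  constructor
  · intro h
    rcases h1 with h1 | h1
    · exact h1.symm.trans (h.1 h1)
    · rcases h2 with h2 | h2
      · exact (h.2 h2).symm.trans h2
      · exact h1.symm.trans h2
  · exact fun h => ⟨fun h' => h'.trans h, fun h' => h'.trans h.symm⟩

theorem IsTree.edgeSide_ne_of_adj (hT : T.IsTree) {u v : V} (h : T.Adj u v) :
    edgeSide (T := T) ⟨s(u, v), h⟩ u ≠ edgeSide (T := T) ⟨s(u, v), h⟩ v := by
  rw [Ne, hT.edgeSide_eq_iff]
  exact isBridge_iff.1 (isAcyclic_iff_forall_isBridge.1 hT.isAcyclic h)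

theorem IsTree.edgeSide_eq_of_adj (hT : T.IsTree) {u v : V} (h : T.Adj u v) {e : T.edgeSet}
    (he : s(u, v) ≠ e.1) : edgeSide e u = edgeSide e v := by
  rw [hT.edgeSide_eq_iff]
  refine Adj.reachable ?_
  rw [deleteEdges_adj]
  exact ⟨h, he⟩

theorem edgeEndpoint_adj (e : T.edgeSet) (c : Bool) :
    T.Adj (edgeEndpoint e c) (edgeEndpoint e !c) := by
  rw [← mem_edgeSet, mk_edgeEndpoint]
  exact e.2

theorem IsTree.edgeSide_endpoint (hT : T.IsTree) (e : T.edgeSet) (c : Bool) :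
    edgeSide e (edgeEndpoint e c) = c := by
  have h1 : edgeSide e (edgeEndpoint e true) = true := by
    simp [edgeSide, edgeEndpoint]
  have h2 := isAcyclic_iff_forall_isBridge.1 hT.isAcyclic e.2
  rw [← mk_edgeEndpoint e true, isBridge_iff, mk_edgeEndpoint, ← hT.edgeSide_eq_iff, h1] at h2
  cases c
  · exact (Bool.eq_false_iff.2 (Ne.symm h2))
  · exact h1

/-- The splits of the vertex set of a tree by its edges. -/
noncomputable def IsTree.treeSiding (hT : T.IsTree) : TreeSiding T.edgeSet V where
  side := edgeSide
  endpoint := edgeEndpoint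
  side_endpoint := hT.edgeSide_endpoint
  side_endpoint_of_ne e f hfe c d := by
    have h : ∀ b, edgeSide f (edgeEndpoint e b) = edgeSide f (edgeEndpoint e !b) := fun b =>
      hT.edgeSide_eq_of_adj (edgeEndpoint_adj e b) (by
        rw [mk_edgeEndpoint]
        exact fun h => hfe (Subtype.ext h.symm))
    cases c <;> cases d <;> first | rfl | exact h _
  exists_empty_corner e f hef := by
    set x := edgeEndpoint f true
    -- If `f` separated `u` from `v`, a walk joining them in `T - e` would use `f`, putting its
    -- endpoint `x` on their side of `e`.
    have key : ∀ u v, edgeSide e u ≠ edgeSide e x → edgeSide e u = edgeSide e v →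
        edgeSide f u = edgeSide f v := by
      intro u v hu huv
      by_contra hne
      obtain ⟨y, z, huy, hyz, hyz'⟩ := exists_adj_of_reachable_of_ne (hT.edgeSide_eq_iff.1 huv) hne
      have hadj := (T.deleteEdges_le _) hyz
      have hf : s(y, z) = s(x, edgeEndpoint f false) := by
        rw [show s(x, edgeEndpoint f false) = f.1 from mk_edgeEndpoint f true]
        by_contra h
        exact hyz' (hT.edgeSide_eq_of_adj hadj h)
      refine hu ((hT.edgeSide_eq_iff.2 huy).trans ?_)
      rcases Sym2.eq_iff.1 hf with ⟨h, -⟩ | ⟨-, h⟩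
      · rw [h]
      · rw [← h]
        exact hT.edgeSide_eq_iff.2 hyz.reachable
    set y := edgeEndpoint e (!edgeSide e x)
    have hy : edgeSide e y = !edgeSide e x := hT.edgeSide_endpoint e _
    refine ⟨!edgeSide e x, !edgeSide f y, fun v hv => ?_⟩
    rw [← key y v (by rw [hy]; simp) (hy.trans hv.symm)]
    simp
  ext_of_side u v h := by
    have h1 : (T.deleteEdges T.edgeSet).Reachable u v := by
      rw [hT.isAcyclic.reachable_deleteEdges_iff]
      exact ⟨hT.connected.preconnected u v, fun e he => hT.edgeSide_eq_iff.1 (h ⟨e, he⟩)⟩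
    rw [deleteEdges_edgeSet, _root_.sdiff_self, reachable_bot] at h1
    exact h1

theorem IsTree.cutPartition_parts [Fintype V] [DecidableEq V] (hT : T.IsTree)
    (S : Finset T.edgeSet) : (T.cutPartition S).parts = hT.treeSiding.cutParts S := by
  classical
  set G := T.deleteEdges {e | ∃ h : e ∈ T.edgeSet, ⟨e, h⟩ ∈ S} with hG
  have hcls : ∀ v, hT.treeSiding.cutClass S v = (G.connectedComponentMk v).supp.toFinset := by
    intro v
    ext w
    rw [TreeSiding.mem_cutClass, Set.mem_toFinset, ConnectedComponent.mem_supp_iff,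
      ConnectedComponent.eq, reachable_comm, hG, hT.isAcyclic.reachable_deleteEdges_iff]
    constructor
    · intro h
      refine ⟨hT.connected.preconnected v w, ?_⟩
      rintro e ⟨he, heS⟩
      exact hT.edgeSide_eq_iff.1 (h _ heS)
    · intro h e he
      exact hT.edgeSide_eq_iff.2 (h.2 e.1 ⟨e.2, he⟩)
  have hcl : hT.treeSiding.cutClasses S =
      (Finset.univ : Finset G.ConnectedComponent).image fun c => c.supp.toFinset := by
    ext C
    simp only [TreeSiding.mem_cutClasses, Finset.mem_image, Finset.mem_univ, true_and, hcls]
    constructor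
    · rintro ⟨v, rfl⟩
      exact ⟨_, rfl⟩
    · rintro ⟨c, rfl⟩
      induction c using ConnectedComponent.ind with
      | h v => exact ⟨v, rfl⟩
  rw [TreeSiding.cutParts, hcl, Finset.image_val_of_injOn, Multiset.map_map]
  · simp only [Function.comp_def, ← Set.ncard_eq_toFinset_card']
    unfold cutPartition
    dsimp only
    congr!
  · intro c _ d _ h
    exact ConnectedComponent.supp_injective (Set.toFinset_inj.1 h)

end SimpleGraph

/-! ### From split systems back to graphs -/

/-- Relabel the edges of a `TreeSiding`. -/
def TreeSiding.reindex {E F V : Type*} (χ : TreeSiding F V) (σ : E ≃ F) : TreeSiding E V where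
  side e := χ.side (σ e)
  endpoint e := χ.endpoint (σ e)
  side_endpoint e := χ.side_endpoint (σ e)
  side_endpoint_of_ne e f h := χ.side_endpoint_of_ne (σ e) (σ f) (σ.injective.ne h)
  exists_empty_corner e f h := χ.exists_empty_corner (σ e) (σ f) (σ.injective.ne h)
  ext_of_side u v h := χ.ext_of_side u v fun e => by simpa using h (σ.symm e)

theorem TreeSiding.cutParts_reindex {E F V : Type*} [Fintype V] [DecidableEq V]
    (χ : TreeSiding F V) (σ : E ≃ F) (S : Finset E) :
    (χ.reindex σ).cutParts S = χ.cutParts (S.map σ.toEmbedding) := by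
  have : (χ.reindex σ).cutClass S = χ.cutClass (S.map σ.toEmbedding) := by
    ext v w
    rw [TreeSiding.mem_cutClass, TreeSiding.mem_cutClass, Finset.forall_mem_map]
    rfl
  rw [TreeSiding.cutParts, TreeSiding.cutParts, TreeSiding.cutClasses, TreeSiding.cutClasses, this]

theorem mainTheorem1 {V W : Type*} [Fintype V] [Fintype W] (n k : ℕ) (hn : 4 ≤ n)
    (hk : 3 ≤ k) (hkn : k ≤ n - 3)
    (T : SimpleGraph V) (hT : T.IsTree) (hV : Fintype.card V = n)
    (T' : SimpleGraph W) (hT' : T'.IsTree) (hW : Fintype.card W = n)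
    (σ : T.edgeSet ≃ T'.edgeSet) (hσ : T.SameLabeledCuts T' σ k) :
    ∃ φ : T ≃g T', ∀ e : T.edgeSet, φ.mapEdgeSet e = σ e := by
  classical
  have hE : Fintype.card T.edgeSet + 1 = n := by
    rw [← hV, ← hT.card_edgeFinset, SimpleGraph.edgeFinset_card]
  set χ := hT.treeSiding with hχ
  set χ' := hT'.treeSiding.reindex σ with hχ'
  have hcut : ∀ S : Finset T.edgeSet, S.card = k → χ.cutParts S = χ'.cutParts S := by
    intro S hS
    rw [hχ', TreeSiding.cutParts_reindex, ← hT'.cutPartition_parts, ← hT.cutPartition_parts]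
    exact hσ S hS
  obtain ⟨φ, hφ⟩ := TreeSiding.exists_equiv (χ := χ) (χ' := χ') (hV.trans hW.symm) fun S hS =>
    TreeSiding.cutParts_eq_of_card_le χ χ' (by omega) hcut S (hS.trans hk)
  -- Only `σ e` separates `φ u` from `φ v`, so these are its endpoints.
  have hmap : ∀ u v (h : T.Adj u v), s(φ u, φ v) = (σ ⟨s(u, v), h⟩).1 := by
    intro u v h
    set e : T.edgeSet := ⟨s(u, v), h⟩
    have hne : χ'.side e (φ u) ≠ χ'.side e (φ v) := fun h' =>
      hT.edgeSide_ne_of_adj h ((hφ e u v).1 h')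
    have heq : ∀ f, f ≠ e → χ'.side f (φ u) = χ'.side f (φ v) := fun f hf =>
      (hφ f u v).2 (hT.edgeSide_eq_of_adj h fun h' => hf (Subtype.ext h'.symm))
    rw [← TreeSiding.endpoint_eq_of_side_eq hne heq,
      ← TreeSiding.endpoint_eq_of_side_eq hne.symm fun f hf => (heq f hf).symm,
      Bool.eq_not_of_ne hne.symm]
    exact SimpleGraph.mk_edgeEndpoint (σ e) _
  have hadj : ∀ u v, T'.Adj (φ u) (φ v) ↔ T.Adj u v := by
    intro u v
    constructor
    · intro h
      obtain ⟨⟨e, he⟩, hσe⟩ := σ.surjective ⟨s(φ u, φ v), h⟩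
      induction e using Sym2.ind with
      | _ x y =>
        have h1 := hmap x y he
        rw [hσe] at h1
        rcases Sym2.eq_iff.1 h1 with ⟨hx, hy⟩ | ⟨hx, hy⟩
        · rw [← φ.injective hx, ← φ.injective hy]
          exact he
        · rw [← φ.injective hx, ← φ.injective hy]
          exact SimpleGraph.Adj.symm he
    · intro h
      rw [← SimpleGraph.mem_edgeSet, hmap u v h]
      exact (σ _).2
  refine ⟨⟨φ, fun {u v} => hadj u v⟩, ?_⟩
  rintro ⟨e, he⟩
  induction e using Sym2.ind with
  | _ x y => exact Subtype.ext (hmap x y he)
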